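/- Let $v=(v_1,v_2,v_3)\in\mathbb{Z}^3$ satisfy $v_1+v_2+v_3=0$, $v_1v_2v_3\neq 0$ and $\gcd(v_1,v_2,v_3)=1$. Then there exist a polynomial $\Phi\in\mathbb{Q}[z]$ that is a finite product (possibly empty, repetitions allowed) of cyclotomic polynomials, with $\Phi(1)\neq 0$, and a $\mathbb{Q}$-subalgebra $C$ of $\mathbb{Q}[z^{\pm}]/(\Phi)$, where $\mathbb{Q}[z^{\pm}]$ denotes the ring of Laurent polynomials in $z$ and $(\Phi)$ the ideal of it generated by $\Phi$, such that for every $F\in\mathbb{Q}[z^{\pm}]$ the following are equivalent: 1. There is a symmetric polynomial $P\in\mathbb{Q}[x_1,x_2,x_3]$ with $F(z)=P(z^{v_1},z^{v_2},z^{v_3})$ in $\mathbb{Q}[z^{\pm}]$. 2. $F'(1)=0$, where $F'$ is the derivative of $F$ with respect to $z$, and the residue class of $F$ modulo $\Phi$ lies in $C$. -/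

import Mathlib

open scoped LaurentPolynomial

noncomputable section

/-- The formal derivative `F'` of a Laurent polynomial `F` with rational coefficients:
`(∑ aₙ zⁿ)' = ∑ n aₙ zⁿ⁻¹`. -/
def laurentDerivative (F : ℚ[T;T⁻¹]) : ℚ[T;T⁻¹] :=
  F.coeff.sum fun n a => LaurentPolynomial.C ((n : ℚ) * a) * LaurentPolynomial.T (n - 1)

/-- The value `F(1)` of a Laurent polynomial at `z = 1`. -/
def laurentEvalOne (F : ℚ[T;T⁻¹]) : ℚ :=
  LaurentPolynomial.eval₂ (RingHom.id ℚ) (1 : ℚˣ) F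

/-- The substitution `P_v(z) = P(z^{v₁}, z^{v₂}, z^{v₃})`, a Laurent polynomial in `z`. -/
def substPowers (v : Fin 3 → ℤ) (P : MvPolynomial (Fin 3) ℚ) : ℚ[T;T⁻¹] :=
  MvPolynomial.aeval (fun i => (LaurentPolynomial.T (v i) : ℚ[T;T⁻¹])) P

/-- `Φ` is a finite (possibly empty) product of cyclotomic polynomials `Φₙ`, `n ≥ 1`,
repetitions allowed. -/
def IsProductOfCyclotomics (Φ : Polynomial ℚ) : Prop :=
  ∃ s : Multiset ℕ, (∀ n ∈ s, 0 < n) ∧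
    Φ = (s.map fun n => Polynomial.cyclotomic n ℚ).prod

/-- The quotient ring `ℚ[z^±]/(Φ)` for a polynomial `Φ ∈ ℚ[z]`. -/
abbrev LaurentQuotient (Φ : Polynomial ℚ) : Type :=
  ℚ[T;T⁻¹] ⧸ Ideal.span {Polynomial.toLaurent Φ}

end

/-!
Write `B = ℚ[z^±]` and let `A ⊆ B` be the subalgebra of all `P(z^{v₁}, z^{v₂}, z^{v₃})` with `P`
symmetric (`symmAlgebra v`). Since `v` is primitive of sum zero, the `z^{vᵢ}` generate `B` and are
roots of `X³ - e₁ X² + e₂ X - 1` with `e₁, e₂ ∈ A`, so `B` is finite over `A`. Geometrically `B` is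
the normalization of the curve `Spec A`, and the theorem says that this curve has a cusp at `z = 1`
and that all its other singularities lie at roots of unity.

*Conductor* (`exists_conductor`). Let `d` be a polynomial in three variables vanishing at
`(z^{w₁}, z^{w₂}, z^{w₃})` for every permutation `w ≠ v` of `v`. Symmetrizing `d · p` and
restricting to `v` leaves a nonzero multiple of `d · p`, whence `d(z^v) B ⊆ A`. Taking for `d` a
product of binomials, one for each `σ` with `w = v ∘ σ ≠ v`, its restriction to `v` is up to a unit
the product of the `z^k - 1` with `k = v₁ w₂ - v₂ w₁ ≠ 0`. Hence `(z - 1)⁵ Φ B ⊆ A`, where `Φ` is a product of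
cyclotomic polynomials and `Φ(1) ≠ 0`.

*Behaviour at `1`* (`exists_mem_add_pow_five`). The elements `e₁ - 3`, `e₁ - e₂` and `(e₁ - 3)²` of
`A` vanish at `1` to the exact orders `2`, `3` and `4`, so modulo `(z - 1)⁵` the algebra `A`
contains every multiple of `(z - 1)²`.

*Separation* (`exists_separating`). The ideal `(e₁ - 3, e₂ - 3)` of `B` contains a power of `z - 1`.
Nakayama's lemma for the `A`-module `B` provides `e ∈ A` with `Φ ∣ e` and `e ≡ 1` modulo
`(z - 1)⁵`.

If now `F'(1) = 0` and `Φ ∣ F`, choose `a ∈ A` with `a ≡ F` modulo `(z - 1)⁵`; then `F - a e` is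
divisible by `(z - 1)⁵ Φ`, so `F ∈ A` (`mem_symmAlgebra_of_dvd`). Conversely every element of `A`
has derivative zero at `1`. Thus membership in `A` is tested by `F'(1) = 0` and the residue class
modulo `Φ`, with `C` the image of `A`.
-/

open LaurentPolynomial

/-! ### First-order Taylor expansion at `z = 1` -/

/-- Evaluation at `z = 1`, as a homomorphism of `ℚ`-algebras. -/
noncomputable def evalOne : ℚ[T;T⁻¹] →ₐ[ℚ] ℚ :=
  { LaurentPolynomial.eval₂ (RingHom.id ℚ) (1 : ℚˣ) with
    commutes' := fun r => by
      simp [← LaurentPolynomial.C_eq_algebraMap] }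

theorem laurentEvalOne_eq_evalOne (F : ℚ[T;T⁻¹]) : laurentEvalOne F = evalOne F := rfl

@[simp]
theorem evalOne_T (n : ℤ) : evalOne (T n) = 1 := by
  simp [← laurentEvalOne_eq_evalOne, laurentEvalOne]

@[simp]
theorem evalOne_C (a : ℚ) : evalOne (C a) = a := by
  simp [← laurentEvalOne_eq_evalOne, laurentEvalOne]

theorem evalOne_toLaurent (p : Polynomial ℚ) : evalOne (Polynomial.toLaurent p) = p.eval 1 := by
  simp [← laurentEvalOne_eq_evalOne, laurentEvalOne]

/-- The linear functional `F ↦ F'(1)`. -/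
noncomputable def derivAtOne : ℚ[T;T⁻¹] →ₗ[ℚ] ℚ :=
  Finsupp.lsum ℚ (fun n : ℤ => LinearMap.mulLeft ℚ (n : ℚ)) ∘ₗ
    (AddMonoidAlgebra.coeffLinearEquiv ℚ).toLinearMap

theorem laurentEvalOne_laurentDerivative (F : ℚ[T;T⁻¹]) :
    laurentEvalOne (laurentDerivative F) = derivAtOne F := by
  rw [laurentEvalOne_eq_evalOne, laurentDerivative, Finsupp.sum, map_sum]
  simp [derivAtOne, Finsupp.sum]

@[simp]
theorem derivAtOne_T (n : ℤ) : derivAtOne (T n) = n := by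
  rw [derivAtOne, LinearMap.comp_apply, LinearEquiv.coe_coe, T,
    AddMonoidAlgebra.coeffLinearEquiv_apply, AddMonoidAlgebra.coeff_single]
  simp [-map_one]

@[simp]
theorem derivAtOne_C (a : ℚ) : derivAtOne (C a) = 0 := by
  simp [derivAtOne, ← single_eq_C, -single_eq_C_mul_T]

/-- Leibniz' rule at `z = 1`. -/
theorem derivAtOne_mul (F G : ℚ[T;T⁻¹]) :
    derivAtOne (F * G) = derivAtOne F * evalOne G + evalOne F * derivAtOne G := by
  induction F using LaurentPolynomial.induction_on' with
  | add p q hp hq => simp only [add_mul, map_add, hp, hq]; ring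
  | C_mul_T n a =>
    induction G using LaurentPolynomial.induction_on' with
    | add p q hp hq => simp only [mul_add, map_add, hp, hq]; ring
    | C_mul_T m b =>
      have : (C a * T n * (C b * T m) : ℚ[T;T⁻¹]) = (a * b) • T (n + m) := by
        rw [smul_eq_C_mul, T_add, map_mul]; ring
      rw [this]
      simp only [← smul_eq_C_mul, map_smul, derivAtOne_T, evalOne_T, smul_eq_mul]
      push_cast; ring

/-- `zⁿ - 1` vanishes at `z = 1`, with derivative `n` there. -/
theorem exists_T_sub_one_eq (n : ℤ) :
    ∃ h : ℚ[T;T⁻¹], T n - 1 = (T 1 - 1) * h ∧ evalOne h = n := by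
  have key : ∃ h : ℚ[T;T⁻¹], T n - 1 = (T 1 - 1) * h := by
    induction n using Int.induction_on with
    | zero => exact ⟨0, by simp⟩
    | succ n ih =>
      obtain ⟨h, hh⟩ := ih
      refine ⟨h * T 1 + 1, ?_⟩
      rw [T_add]; linear_combination T 1 * hh
    | pred n ih =>
      obtain ⟨h, hh⟩ := ih
      refine ⟨h * T (-1) - T (-1), ?_⟩
      have h1 : (T 1 * T (-1) : ℚ[T;T⁻¹]) = 1 := by rw [← T_add]; simp
      rw [T_sub]; linear_combination T (-1) * hh + h1
  obtain ⟨h, hh⟩ := key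
  refine ⟨h, hh, ?_⟩
  have := congrArg derivAtOne hh
  have h1 : derivAtOne (1 : ℚ[T;T⁻¹]) = 0 := by simpa using derivAtOne_C 1
  simpa [derivAtOne_mul, h1] using this.symm

theorem exists_eq_C_add (F : ℚ[T;T⁻¹]) : ∃ G, F = C (evalOne F) + (T 1 - 1) * G := by
  induction F using LaurentPolynomial.induction_on' with
  | add p q hp hq =>
    obtain ⟨g, hg⟩ := hp
    obtain ⟨h, hh⟩ := hq
    refine ⟨g + h, ?_⟩
    rw [map_add, map_add]; linear_combination hg + hh
  | C_mul_T n a =>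
    obtain ⟨h, hh, -⟩ := exists_T_sub_one_eq n
    refine ⟨C a * h, ?_⟩
    simp only [map_mul, evalOne_C, evalOne_T, map_one]
    linear_combination C a * hh

/-- A Laurent polynomial with vanishing derivative at `1` is constant to second order there. -/
theorem exists_eq_C_add_sq {F : ℚ[T;T⁻¹]} (hF : derivAtOne F = 0) :
    ∃ G, F = C (evalOne F) + (T 1 - 1) ^ 2 * G := by
  obtain ⟨G, hG⟩ := exists_eq_C_add F
  have h1 : derivAtOne (1 : ℚ[T;T⁻¹]) = 0 := by simpa using derivAtOne_C 1
  have h0 : evalOne G = 0 := by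
    have := congrArg derivAtOne hG
    simpa [derivAtOne_mul, h1, hF] using this.symm
  obtain ⟨H, hH⟩ := exists_eq_C_add G
  refine ⟨H, ?_⟩
  rw [h0, map_zero] at hH
  linear_combination hG + (T 1 - 1) * hH

theorem isCoprime_T_sub_one_pow {Φ : ℚ[T;T⁻¹]} (h : evalOne Φ ≠ 0) (n : ℕ) :
    IsCoprime ((T 1 - 1 : ℚ[T;T⁻¹]) ^ n) Φ := by
  apply IsCoprime.pow_left
  obtain ⟨G, hG⟩ := exists_eq_C_add Φ
  refine ⟨- C (evalOne Φ)⁻¹ * G, C (evalOne Φ)⁻¹, ?_⟩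
  have : (C (evalOne Φ)⁻¹ * C (evalOne Φ) : ℚ[T;T⁻¹]) = 1 := by
    rw [← map_mul, inv_mul_cancel₀ h, map_one]
  linear_combination C (evalOne Φ)⁻¹ * hG + this

/-! ### The algebra of symmetric polynomials in three powers of `z` -/

/-- The `ℚ`-subalgebra of `ℚ[z^±]` formed by the `P(z^{v₁}, z^{v₂}, z^{v₃})` with `P` symmetric. -/
noncomputable def symmAlgebra (v : Fin 3 → ℤ) : Subalgebra ℚ ℚ[T;T⁻¹] :=
  (MvPolynomial.symmetricSubalgebra (Fin 3) ℚ).map (MvPolynomial.aeval fun i => T (v i))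

theorem mem_symmAlgebra {v : Fin 3 → ℤ} {F : ℚ[T;T⁻¹]} :
    F ∈ symmAlgebra v ↔ ∃ P : MvPolynomial (Fin 3) ℚ, P.IsSymmetric ∧ F = substPowers v P := by
  simp only [symmAlgebra, Subalgebra.mem_map, MvPolynomial.mem_symmetricSubalgebra, substPowers,
    eq_comm]

theorem substPowers_mul (v : Fin 3 → ℤ) (P Q : MvPolynomial (Fin 3) ℚ) :
    substPowers v (P * Q) = substPowers v P * substPowers v Q :=
  map_mul (MvPolynomial.aeval _) P Q

theorem substPowers_rename (v : Fin 3 → ℤ) (σ : Fin 3 → Fin 3) (P : MvPolynomial (Fin 3) ℚ) :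
    substPowers v (MvPolynomial.rename σ P) = substPowers (v ∘ σ) P := by
  rw [substPowers, MvPolynomial.aeval_rename]; rfl

theorem evalOne_substPowers (v : Fin 3 → ℤ) (P : MvPolynomial (Fin 3) ℚ) :
    evalOne (substPowers v P) = MvPolynomial.eval (fun _ => 1) P := by
  induction P using MvPolynomial.induction_on with
  | C a => simp [substPowers]
  | add p q hp hq => simpa [substPowers] using congrArg₂ (· + ·) hp hq
  | mul_X p i hp => rw [substPowers_mul, map_mul, hp]; simp [substPowers]

theorem derivAtOne_substPowers (v : Fin 3 → ℤ) (P : MvPolynomial (Fin 3) ℚ) :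
    derivAtOne (substPowers v P) =
      ∑ i, (v i : ℚ) * MvPolynomial.eval (fun _ => 1) (MvPolynomial.pderiv i P) := by
  induction P using MvPolynomial.induction_on with
  | C a =>
    simp [substPowers, ← LaurentPolynomial.C_eq_algebraMap]
  | add p q hp hq =>
    simp only [substPowers, map_add, mul_add, Finset.sum_add_distrib] at hp hq ⊢
    rw [hp, hq]
  | mul_X p i hp =>
    have hX : substPowers v (MvPolynomial.X i) = T (v i) := by simp [substPowers]
    simp only [substPowers_mul, derivAtOne_mul, hp, hX, evalOne_substPowers, evalOne_T,
      derivAtOne_T, Derivation.leibniz, MvPolynomial.pderiv_X, map_add, smul_eq_mul, map_mul,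
      MvPolynomial.eval_X, mul_add, Finset.sum_add_distrib, Pi.single_apply]
    simp [mul_comm, add_comm]

/-- All first partial derivatives of a symmetric polynomial agree at `(1, 1, 1)`, so the chain rule
gives derivative `(v₁ + v₂ + v₃) · c = 0`. -/
theorem derivAtOne_eq_zero_of_mem {v : Fin 3 → ℤ} (hsum : v 0 + v 1 + v 2 = 0) {F : ℚ[T;T⁻¹]}
    (hF : F ∈ symmAlgebra v) : derivAtOne F = 0 := by
  obtain ⟨P, hP, rfl⟩ := mem_symmAlgebra.1 hF
  have key : ∀ i, MvPolynomial.eval (fun _ => (1 : ℚ)) (MvPolynomial.pderiv i P) =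
      MvPolynomial.eval (fun _ => (1 : ℚ)) (MvPolynomial.pderiv 0 P) := by
    intro i
    have h := MvPolynomial.pderiv_rename (Equiv.swap 0 i).injective 0 P
    rw [hP (Equiv.swap 0 i), Equiv.swap_apply_left] at h
    rw [h, MvPolynomial.eval_rename]
    rfl
  rw [derivAtOne_substPowers, Fin.sum_univ_three, key 1, key 2]
  have : (v 0 + v 1 + v 2 : ℚ) = 0 := by exact_mod_cast hsum
  linear_combination MvPolynomial.eval (fun _ => (1 : ℚ)) (MvPolynomial.pderiv 0 P) * this

/-- The power sums `z^{k v₁} + z^{k v₂} + z^{k v₃}` lie in the algebra. -/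
theorem sum_T_mem (v : Fin 3 → ℤ) (k : ℕ) : ∑ i, T (k * v i) ∈ symmAlgebra v :=
  mem_symmAlgebra.2 ⟨MvPolynomial.psum (Fin 3) ℚ k, MvPolynomial.psum_isSymmetric _ _ k, by
    simp [substPowers, MvPolynomial.psum]⟩

theorem T_add_T_add_T_mem (v : Fin 3 → ℤ) : T (v 0) + T (v 1) + T (v 2) ∈ symmAlgebra v := by
  simpa [Fin.sum_univ_three] using sum_T_mem v 1

theorem T_mul_T_mul_T {v : Fin 3 → ℤ} (hsum : v 0 + v 1 + v 2 = 0) :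
    (T (v 0) * T (v 1) * T (v 2) : ℚ[T;T⁻¹]) = 1 := by
  rw [← T_add, ← T_add, hsum, T_zero]

theorem esymm_two_mem (v : Fin 3 → ℤ) :
    T (v 0) * T (v 1) + T (v 0) * T (v 2) + T (v 1) * T (v 2) ∈ symmAlgebra v := by
  have h2 := sum_T_mem v 2
  have h := (symmAlgebra v).smul_mem
    ((symmAlgebra v).sub_mem ((symmAlgebra v).pow_mem (T_add_T_add_T_mem v) 2) h2) (1 / 2)
  convert h using 1
  simp only [Fin.sum_univ_three, ← T_pow]
  rw [smul_eq_C_mul]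
  have hC : (C (1 / 2) * 2 : ℚ[T;T⁻¹]) = 1 := by
    rw [← map_ofNat C 2, ← map_mul]; norm_num
  linear_combination (-(T (v 0) * T (v 1) + T (v 0) * T (v 2) + T (v 1) * T (v 2))) * hC

theorem one_mem_of_gcd_eq_one {ι : Type*} [Fintype ι] {v : ι → ℤ}
    (hgcd : Finset.univ.gcd v = 1) (H : AddSubgroup ℤ) (hH : ∀ i, v i ∈ H) : (1 : ℤ) ∈ H := by
  obtain ⟨a, rfl⟩ := Int.subgroup_cyclic H
  have ha : a ∣ 1 := by
    rw [← hgcd]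
    refine Finset.dvd_gcd fun i _ => ?_
    obtain ⟨k, hk⟩ := AddSubgroup.mem_closure_singleton.1 (hH i)
    exact ⟨k, by rw [← hk, smul_eq_mul, mul_comm]⟩
  obtain ⟨k, hk⟩ := ha
  exact AddSubgroup.mem_closure_singleton.2 ⟨k, by rw [hk, smul_eq_mul, mul_comm]⟩

/-- As `v` is primitive with sum zero, every Laurent polynomial is a polynomial in the `z^{vᵢ}`:
`z^{-v₁}` is `z^{v₂} z^{v₃}`, and the `vᵢ` generate `ℤ`. -/
theorem substPowers_surjective {v : Fin 3 → ℤ} (hsum : v 0 + v 1 + v 2 = 0)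
    (hgcd : Finset.univ.gcd v = 1) : Function.Surjective (substPowers v) := by
  set R : Subalgebra ℚ ℚ[T;T⁻¹] :=
    (MvPolynomial.aeval fun i => (T (v i) : ℚ[T;T⁻¹]) : MvPolynomial (Fin 3) ℚ →ₐ[ℚ] _).range
    with hR
  have hv : ∀ i, T (v i) ∈ R := fun i => ⟨MvPolynomial.X i, by simp⟩
  have hnv : ∀ i, T (-v i) ∈ R := by
    intro i
    fin_cases i
    · have : -v 0 = v 1 + v 2 := by omega
      change T (-v 0) ∈ R
      rw [this, T_add]
      exact R.mul_mem (hv 1) (hv 2)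
    · have : -v 1 = v 0 + v 2 := by omega
      change T (-v 1) ∈ R
      rw [this, T_add]
      exact R.mul_mem (hv 0) (hv 2)
    · have : -v 2 = v 0 + v 1 := by omega
      change T (-v 2) ∈ R
      rw [this, T_add]
      exact R.mul_mem (hv 0) (hv 1)
  let H : AddSubgroup ℤ :=
    { carrier := {n | T n ∈ R ∧ T (-n) ∈ R}
      zero_mem' := by simp [R.one_mem]
      add_mem' := fun {a b} ha hb => by
        refine ⟨?_, ?_⟩
        · rw [T_add]; exact R.mul_mem ha.1 hb.1
        · rw [neg_add, T_add]; exact R.mul_mem ha.2 hb.2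
      neg_mem' := fun {a} ha => ⟨ha.2, by rw [neg_neg]; exact ha.1⟩ }
  have h1 : (1 : ℤ) ∈ H := one_mem_of_gcd_eq_one hgcd H fun i => ⟨hv i, hnv i⟩
  have hT : ∀ n : ℤ, T n ∈ R := fun n => by
    have : n ∈ H := by simpa using H.zsmul_mem h1 n
    exact this.1
  intro F
  suffices F ∈ R from this
  induction F using LaurentPolynomial.induction_on' with
  | add p q hp hq => exact R.add_mem hp hq
  | C_mul_T n a => rw [← smul_eq_C_mul]; exact R.smul_mem (hT n) a

/-! ### The conductor -/

theorem IsProductOfCyclotomics.one : IsProductOfCyclotomics 1 := ⟨0, by simp, by simp⟩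

theorem IsProductOfCyclotomics.mul {Φ Ψ : Polynomial ℚ} (hΦ : IsProductOfCyclotomics Φ)
    (hΨ : IsProductOfCyclotomics Ψ) : IsProductOfCyclotomics (Φ * Ψ) := by
  obtain ⟨s, hs, rfl⟩ := hΦ
  obtain ⟨t, ht, rfl⟩ := hΨ
  refine ⟨s + t, fun n hn => ?_, by simp⟩
  rcases Multiset.mem_add.1 hn with h | h
  exacts [hs n h, ht n h]

theorem isProductOfCyclotomics_geom_sum {n : ℕ} (hn : 0 < n) :
    IsProductOfCyclotomics (∑ i ∈ Finset.range n, Polynomial.X ^ i) := by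
  refine ⟨(n.divisors.erase 1).val, fun m hm => ?_, ?_⟩
  · exact Nat.pos_of_mem_divisors (Finset.mem_of_mem_erase (Finset.mem_def.2 hm))
  · exact (Polynomial.prod_cyclotomic_eq_geom_sum hn ℚ).symm

theorem exists_T_sub_one_eq_unit_mul (k : ℤ) :
    ∃ u : ℚ[T;T⁻¹], IsUnit u ∧ T k - 1 = u * ((T 1 - 1) *
      Polynomial.toLaurent (∑ i ∈ Finset.range k.natAbs, Polynomial.X ^ i)) := by
  have key : ∀ n : ℕ, (T n - 1 : ℚ[T;T⁻¹]) = (T 1 - 1) *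
      Polynomial.toLaurent (∑ i ∈ Finset.range n, Polynomial.X ^ i) := by
    intro n
    have := congrArg Polynomial.toLaurent (mul_geom_sum (Polynomial.X : Polynomial ℚ) n)
    simpa using this.symm
  rcases le_total 0 k with h | h
  · refine ⟨1, isUnit_one, ?_⟩
    rw [one_mul, ← key, Int.natAbs_of_nonneg h]
  · refine ⟨-T k, (isUnit_T k).neg, ?_⟩
    have h1 : (T k * T (-k) : ℚ[T;T⁻¹]) = 1 := by rw [← T_add]; simp
    rw [← key, Int.ofNat_natAbs_of_nonpos h]
    linear_combination h1

/-- The symmetrization of `d · p`, for `d` vanishing on the curves parametrized by the permutations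
of `v` different from `v`, restricts to a multiple of `d · p` on the curve of `v`. -/
theorem substPowers_mul_mem {v : Fin 3 → ℤ} (hsum : v 0 + v 1 + v 2 = 0)
    (hgcd : Finset.univ.gcd v = 1) {d : MvPolynomial (Fin 3) ℚ}
    (hd : ∀ σ : Equiv.Perm (Fin 3), v ∘ σ ≠ v → substPowers (v ∘ σ) d = 0) (F : ℚ[T;T⁻¹]) :
    substPowers v d * F ∈ symmAlgebra v := by
  obtain ⟨p, rfl⟩ := substPowers_surjective hsum hgcd F
  have hsymm : (∑ σ : Equiv.Perm (Fin 3), MvPolynomial.rename σ (d * p)).IsSymmetric := by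
    intro τ
    rw [map_sum]
    simp_rw [MvPolynomial.rename_rename]
    exact Fintype.sum_equiv (Equiv.mulLeft τ) _ _ fun σ => rfl
  have hmem := (mem_symmAlgebra (v := v)).2 ⟨_, hsymm, rfl⟩
  have hval : substPowers v (∑ σ : Equiv.Perm (Fin 3), MvPolynomial.rename σ (d * p)) =
      ((Finset.univ.filter fun σ : Equiv.Perm (Fin 3) => v ∘ σ = v).card : ℚ) •
        (substPowers v d * substPowers v p) := by
    have : ∀ σ : Equiv.Perm (Fin 3), substPowers v (MvPolynomial.rename σ (d * p)) =
        if v ∘ σ = v then substPowers v d * substPowers v p else 0 := by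
      intro σ
      rw [substPowers_rename, substPowers_mul]
      split_ifs with h
      · rw [h]
      · rw [hd σ h, zero_mul]
    rw [show substPowers v (∑ σ : Equiv.Perm (Fin 3), MvPolynomial.rename σ (d * p)) =
      ∑ σ : Equiv.Perm (Fin 3), substPowers v (MvPolynomial.rename σ (d * p)) from
        map_sum (MvPolynomial.aeval _) _ _, Finset.sum_congr rfl fun σ _ => this σ,
      Finset.sum_ite, Finset.sum_const, Finset.sum_const_zero, add_zero, Nat.cast_smul_eq_nsmul]
  rw [hval] at hmem
  have hcard : ((Finset.univ.filter fun σ : Equiv.Perm (Fin 3) => v ∘ σ = v).card : ℚ) ≠ 0 := by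
    rw [Nat.cast_ne_zero]
    exact Finset.card_ne_zero_of_mem (a := 1) (by simp)
  simpa [smul_smul, inv_mul_cancel₀ hcard] using (symmAlgebra v).smul_mem hmem
    ((Finset.univ.filter fun σ : Equiv.Perm (Fin 3) => v ∘ σ = v).card : ℚ)⁻¹

/-- A binomial vanishing at `(z^{w₁}, z^{w₂}, z^{w₃})`; positive and negative parts of the exponents
`w₂` and `-w₁` of the first two variables are collected in separate monomials. -/
noncomputable def curveBinomial (w : Fin 3 → ℤ) : MvPolynomial (Fin 3) ℚ :=
  MvPolynomial.X 0 ^ (w 1).toNat * MvPolynomial.X 1 ^ (-w 0).toNat -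
    MvPolynomial.X 0 ^ (-w 1).toNat * MvPolynomial.X 1 ^ (w 0).toNat

theorem substPowers_curveBinomial (v w : Fin 3 → ℤ) :
    ∃ n : ℤ, substPowers v (curveBinomial w) = T n * (T (v 0 * w 1 - v 1 * w 0) - 1) := by
  refine ⟨(-w 1).toNat * v 0 + (w 0).toNat * v 1, ?_⟩
  have h0 := Int.toNat_sub_toNat_neg (w 0)
  have h1 := Int.toNat_sub_toNat_neg (w 1)
  simp only [substPowers, curveBinomial, map_sub, map_mul, map_pow, MvPolynomial.aeval_X, T_pow,
    mul_sub, mul_one, ← T_add]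
  congr 2
  linear_combination v 0 * h1 - v 1 * h0

theorem substPowers_curveBinomial_self (w : Fin 3 → ℤ) :
    substPowers w (curveBinomial w) = 0 := by
  obtain ⟨n, hn⟩ := substPowers_curveBinomial w w
  rw [hn, mul_comm (w 1), sub_self, T_zero, sub_self, mul_zero]

/-- As both vectors have sum zero, the vanishing of one `2 × 2` minor makes `v ∘ σ` proportional to
`v`. Their entries have the same nonzero product, so the cube of the factor is `1`. -/
theorem comp_perm_eq_of_cross_eq_zero {v : Fin 3 → ℤ} (hsum : v 0 + v 1 + v 2 = 0)
    (hprod : v 0 * v 1 * v 2 ≠ 0) (σ : Equiv.Perm (Fin 3))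
    (h : v 0 * v (σ 1) - v 1 * v (σ 0) = 0) : v ∘ σ = v := by
  have hs : v (σ 0) + v (σ 1) + v (σ 2) = 0 := by
    have := Equiv.sum_comp σ v
    simp only [Fin.sum_univ_three] at this
    omega
  have hp : v (σ 0) * v (σ 1) * v (σ 2) = v 0 * v 1 * v 2 := by
    have := Equiv.prod_comp σ v
    simpa only [Fin.prod_univ_three] using this
  have h0 : v 0 ≠ 0 := fun h => hprod (by simp [h])
  have h1 : v 1 ≠ 0 := fun h => hprod (by simp [h])
  have h2 : v 2 ≠ 0 := fun h => hprod (by simp [h])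
  have e2 : v 0 * v (σ 2) = v 2 * v (σ 0) := by
    linear_combination (v 0) * hs - v (σ 0) * hsum - h
  have hcube : v (σ 0) ^ 3 = v 0 ^ 3 := by
    have : (v 1 * v 2) * (v (σ 0) ^ 3 - v 0 ^ 3) = 0 := by
      linear_combination v 0 ^ 2 * hp - v 0 * v (σ 0) * v (σ 2) * h - v 1 * v (σ 0) ^ 2 * e2
    rcases mul_eq_zero.1 this with h' | h'
    · exact absurd h' (mul_ne_zero h1 h2)
    · linarith
  have e0 : v (σ 0) = v 0 := (Odd.strictMono_pow (by decide)).injective hcube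
  funext i
  fin_cases i
  · exact e0
  · refine mul_left_cancel₀ h0 (?_ : v 0 * v (σ 1) = v 0 * v 1)
    rw [e0] at h; linarith
  · refine mul_left_cancel₀ h0 (?_ : v 0 * v (σ 2) = v 0 * v 2)
    rw [e0] at e2; linarith

/-- The conductor of `ℚ[z^±]` over the algebra of symmetric expressions contains `(z - 1)⁵ Φ`
for a product `Φ` of cyclotomic polynomials different from `z - 1`. The exponent `5` is the number
of nontrivial permutations of three letters. -/
theorem exists_conductor {v : Fin 3 → ℤ} (hsum : v 0 + v 1 + v 2 = 0)
    (hprod : v 0 * v 1 * v 2 ≠ 0) (hgcd : Finset.univ.gcd v = 1) :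
    ∃ Φ : Polynomial ℚ, IsProductOfCyclotomics Φ ∧ Φ.eval 1 ≠ 0 ∧
      ∀ F : ℚ[T;T⁻¹], (T 1 - 1) ^ 5 * Polynomial.toLaurent Φ * F ∈ symmAlgebra v := by
  set S := Finset.univ.filter fun σ : Equiv.Perm (Fin 3) => v ∘ σ ≠ v with hS
  set g : Equiv.Perm (Fin 3) → Polynomial ℚ := fun σ =>
    ∑ i ∈ Finset.range (v 0 * v (σ 1) - v 1 * v (σ 0)).natAbs, Polynomial.X ^ i with hg
  have hne : ∀ σ ∈ S, v 0 * v (σ 1) - v 1 * v (σ 0) ≠ 0 := fun σ hσ h =>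
    (Finset.mem_filter.1 hσ).2 (comp_perm_eq_of_cross_eq_zero hsum hprod σ h)
  have hb : ∀ σ ∈ S, ∃ u : ℚ[T;T⁻¹], IsUnit u ∧ substPowers v (curveBinomial (v ∘ σ)) =
      u * ((T 1 - 1) * Polynomial.toLaurent (g σ)) := by
    intro σ hσ
    obtain ⟨n, hn⟩ := substPowers_curveBinomial v (v ∘ σ)
    obtain ⟨u, hu, hk⟩ := exists_T_sub_one_eq_unit_mul (v 0 * v (σ 1) - v 1 * v (σ 0))
    refine ⟨T n * u, (isUnit_T n).mul hu, ?_⟩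
    rw [hn, mul_assoc, ← hk]; rfl
  choose! u hu hub using hb
  refine ⟨∏ σ ∈ S, g σ, ?_, ?_, fun F => ?_⟩
  · refine Finset.prod_induction _ IsProductOfCyclotomics (fun _ _ => .mul) .one fun σ hσ => ?_
    exact isProductOfCyclotomics_geom_sum (Int.natAbs_pos.2 (hne σ hσ))
  · rw [Polynomial.eval_prod, Finset.prod_ne_zero_iff]
    intro σ hσ
    have := hne σ hσ
    simp only [hg, Polynomial.eval_finsetSum, Polynomial.eval_pow, Polynomial.eval_X, one_pow,
      Finset.sum_const, Finset.card_range, nsmul_eq_mul, mul_one]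
    exact_mod_cast Int.natAbs_ne_zero.2 this
  · have hd := substPowers_mul_mem hsum hgcd (d := ∏ σ ∈ S, curveBinomial (v ∘ σ)) (by
      intro τ hτ
      rw [← Finset.mul_prod_erase S _ (Finset.mem_filter.2 ⟨Finset.mem_univ τ, hτ⟩),
        substPowers_mul, substPowers_curveBinomial_self, zero_mul])
    have hprodS : substPowers v (∏ σ ∈ S, curveBinomial (v ∘ σ)) =
        (∏ σ ∈ S, u σ) * ((T 1 - 1) ^ S.card * Polynomial.toLaurent (∏ σ ∈ S, g σ)) := by
      rw [show substPowers v (∏ σ ∈ S, curveBinomial (v ∘ σ)) =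
        ∏ σ ∈ S, substPowers v (curveBinomial (v ∘ σ)) from map_prod (MvPolynomial.aeval _) _ _,
        Finset.prod_congr rfl hub, Finset.prod_mul_distrib, Finset.prod_mul_distrib,
        Finset.prod_const, map_prod]
    have hU : IsUnit (∏ σ ∈ S, u σ) :=
      Finset.prod_induction _ IsUnit (fun _ _ => IsUnit.mul) isUnit_one hu
    obtain ⟨w, hw⟩ := hU.exists_right_inv
    have hcard : S.card ≤ 5 := by
      have h : S ⊆ Finset.univ.erase 1 := fun σ hσ => Finset.mem_erase.2
        ⟨fun h => (Finset.mem_filter.1 hσ).2 (by simp [h]), Finset.mem_univ σ⟩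
      exact (Finset.card_le_card h).trans (by decide)
    have := hd (w * (T 1 - 1) ^ (5 - S.card) * F)
    rw [hprodS] at this
    convert this using 1
    rw [← Nat.sub_add_cancel hcard, pow_add, Nat.sub_add_cancel hcard]
    linear_combination (-((T 1 - 1) ^ (5 - S.card) * (T 1 - 1) ^ S.card *
      Polynomial.toLaurent (∏ σ ∈ S, g σ) * F)) * hw

/-! ### The singularity at `z = 1` -/

/-- `e₁ - 3` vanishes to order exactly `2` at `z = 1`; the leading coefficient is the positive
definite form `v₁² + v₁ v₂ + v₂²`. -/
theorem exists_order_two {v : Fin 3 → ℤ} (hsum : v 0 + v 1 + v 2 = 0) (h0 : v 0 ≠ 0) :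
    ∃ g : ℚ[T;T⁻¹], T (v 0) + T (v 1) + T (v 2) - 3 = (T 1 - 1) ^ 2 * g ∧ evalOne g ≠ 0 := by
  obtain ⟨a, ha, ha'⟩ := exists_T_sub_one_eq (v 0)
  obtain ⟨b, hb, hb'⟩ := exists_T_sub_one_eq (v 1)
  have h1 := T_mul_T_mul_T hsum
  refine ⟨T (v 2) * (a ^ 2 + a * b + b ^ 2 + (T 1 - 1) * a * b * (a + b)), ?_, ?_⟩
  · rw [sub_eq_iff_eq_add] at ha hb
    rw [ha, hb] at h1 ⊢
    linear_combination (-((T 1 - 1) * a + (T 1 - 1) * b - 1)) * h1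
  · simp only [map_mul, map_add, map_pow, map_sub, evalOne_T, map_one, ha', hb']
    have : (v 0 : ℚ) ≠ 0 := by exact_mod_cast h0
    have := sq_pos_of_ne_zero this
    nlinarith [sq_nonneg ((v 0 : ℚ) + 2 * v 1)]

/-- With `e₁, e₂, e₃ = 1` the elementary symmetric functions of the `z^{vᵢ}`, the difference
`e₁ - e₂` is `(z^{v₁} - 1) (z^{v₂} - 1) (z^{v₃} - 1)`. -/
theorem exists_order_three {v : Fin 3 → ℤ} (hsum : v 0 + v 1 + v 2 = 0)
    (hprod : v 0 * v 1 * v 2 ≠ 0) :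
    ∃ g : ℚ[T;T⁻¹], T (v 0) + T (v 1) + T (v 2) -
      (T (v 0) * T (v 1) + T (v 0) * T (v 2) + T (v 1) * T (v 2)) = (T 1 - 1) ^ 3 * g ∧
      evalOne g ≠ 0 := by
  obtain ⟨a, ha, ha'⟩ := exists_T_sub_one_eq (v 0)
  obtain ⟨b, hb, hb'⟩ := exists_T_sub_one_eq (v 1)
  obtain ⟨c, hc, hc'⟩ := exists_T_sub_one_eq (v 2)
  refine ⟨a * b * c, ?_, ?_⟩
  · have h : (T (v 0) - 1) * (T (v 1) - 1) * (T (v 2) - 1) =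
        (T 1 - 1 : ℚ[T;T⁻¹]) ^ 3 * (a * b * c) := by rw [ha, hb, hc]; ring
    linear_combination h - T_mul_T_mul_T hsum
  · rw [map_mul, map_mul, ha', hb', hc']
    exact_mod_cast hprod

/-- An element of exact order `k` at `z = 1` removes the leading coefficient of any Laurent
polynomial vanishing to order `k`. -/
theorem exists_add_of_order {A : Subalgebra ℚ ℚ[T;T⁻¹]} {k : ℕ} {g : ℚ[T;T⁻¹]}
    (hu : (T 1 - 1) ^ k * g ∈ A) (hg : evalOne g ≠ 0) (G : ℚ[T;T⁻¹]) :
    ∃ a ∈ A, ∃ H, (T 1 - 1) ^ k * G = a + (T 1 - 1) ^ (k + 1) * H := by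
  obtain ⟨H, hH⟩ := exists_eq_C_add (G - (evalOne G / evalOne g) • g)
  refine ⟨_, A.smul_mem hu (evalOne G / evalOne g), H, ?_⟩
  rw [map_sub, map_smul, smul_eq_mul, div_mul_cancel₀ _ hg, sub_self, map_zero] at hH
  simp only [smul_eq_C_mul] at hH ⊢
  linear_combination (T 1 - 1) ^ k * hH

/-- The algebra contains elements of exact orders `2`, `3` and `4` at `z = 1`, so modulo
`(z - 1)⁵` it contains everything that vanishes to second order. -/
theorem exists_mem_add_pow_five {v : Fin 3 → ℤ} (hsum : v 0 + v 1 + v 2 = 0)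
    (hprod : v 0 * v 1 * v 2 ≠ 0) (G : ℚ[T;T⁻¹]) :
    ∃ a ∈ symmAlgebra v, ∃ H, (T 1 - 1) ^ 2 * G = a + (T 1 - 1) ^ 5 * H := by
  have h0 : v 0 ≠ 0 := fun h => hprod (by simp [h])
  obtain ⟨g, hg, hg0⟩ := exists_order_two hsum h0
  obtain ⟨h, hh, hh0⟩ := exists_order_three hsum hprod
  have m2 : (T 1 - 1) ^ 2 * g ∈ symmAlgebra v := by
    rw [← hg]
    exact sub_mem (T_add_T_add_T_mem v) (ofNat_mem _ 3)
  have m3 : (T 1 - 1) ^ 3 * h ∈ symmAlgebra v := by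
    rw [← hh]
    exact sub_mem (T_add_T_add_T_mem v) (esymm_two_mem v)
  have m4 : (T 1 - 1) ^ 4 * g ^ 2 ∈ symmAlgebra v := by
    convert mul_mem m2 m2 using 1
    ring
  obtain ⟨a, ha, G₃, e2⟩ := exists_add_of_order m2 hg0 G
  obtain ⟨b, hb, G₄, e3⟩ := exists_add_of_order m3 hh0 G₃
  obtain ⟨c, hc, G₅, e4⟩ := exists_add_of_order m4 (by simpa using hg0) G₄
  exact ⟨a + b + c, add_mem (add_mem ha hb) hc, G₅, by linear_combination e2 + e3 + e4⟩

/-! ### Separating `z = 1` from the other singularities -/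

/-- Each `z^{vᵢ}` is a root of `X³ - e₁ X² + e₂ X - 1`. -/
theorem T_cubic_eq_zero {v : Fin 3 → ℤ} (hsum : v 0 + v 1 + v 2 = 0) (i : Fin 3) :
    T (v i) ^ 3 - (T (v 0) + T (v 1) + T (v 2)) * T (v i) ^ 2 +
      (T (v 0) * T (v 1) + T (v 0) * T (v 2) + T (v 1) * T (v 2)) * T (v i) - 1 =
      (0 : ℚ[T;T⁻¹]) := by
  have h : (T (v i) - T (v 0)) * (T (v i) - T (v 1)) * (T (v i) - T (v 2)) = (0 : ℚ[T;T⁻¹]) := by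
    match i with
    | 0 => ring
    | 1 => ring
    | 2 => ring
  linear_combination h + T_mul_T_mul_T hsum

/-- The ideal of `ℚ[z^±]` generated by `e₁ - 3` and `e₂ - 3` has `z = 1` as its only zero:
modulo it, each `z^{vᵢ}` is a root of `(X - 1)³`. -/
theorem exists_T_sub_one_pow_mem {v : Fin 3 → ℤ} (hsum : v 0 + v 1 + v 2 = 0)
    (hgcd : Finset.univ.gcd v = 1) :
    ∃ n : ℕ, (T 1 - 1 : ℚ[T;T⁻¹]) ^ n ∈ Ideal.span {T (v 0) + T (v 1) + T (v 2) - 3,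
      T (v 0) * T (v 1) + T (v 0) * T (v 2) + T (v 1) * T (v 2) - 3} := by
  set K : Ideal ℚ[T;T⁻¹] := Ideal.span {T (v 0) + T (v 1) + T (v 2) - 3,
      T (v 0) * T (v 1) + T (v 0) * T (v 2) + T (v 1) * T (v 2) - 3} with hK
  let H : AddSubgroup ℤ :=
    { carrier := {n | (T n - 1 : ℚ[T;T⁻¹]) ∈ K.radical}
      zero_mem' := by simp
      add_mem' := fun {a b} ha hb => by
        have h : (T (a + b) - 1 : ℚ[T;T⁻¹]) = T a * (T b - 1) + (T a - 1) := by
          rw [T_add]; ring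
        change (T (a + b) - 1 : ℚ[T;T⁻¹]) ∈ K.radical
        rw [h]
        exact add_mem (Ideal.mul_mem_left _ _ hb) ha
      neg_mem' := fun {a} ha => by
        have h1 : (T (-a) * T a : ℚ[T;T⁻¹]) = 1 := by rw [← T_add]; simp
        have h : (T (-a) - 1 : ℚ[T;T⁻¹]) = -T (-a) * (T a - 1) := by linear_combination h1
        change (T (-a) - 1 : ℚ[T;T⁻¹]) ∈ K.radical
        rw [h]
        exact Ideal.mul_mem_left _ _ ha }
  have hroot : ∀ i, (T (v i) - 1 : ℚ[T;T⁻¹]) ^ 3 =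
      T (v i) ^ 2 * (T (v 0) + T (v 1) + T (v 2) - 3) +
      -T (v i) * (T (v 0) * T (v 1) + T (v 0) * T (v 2) + T (v 1) * T (v 2) - 3) := by
    intro i
    linear_combination T_cubic_eq_zero hsum i
  exact one_mem_of_gcd_eq_one hgcd H fun i => ⟨3, by
    rw [hroot i]
    exact add_mem (Ideal.mul_mem_left _ _ (Ideal.subset_span (Or.inl rfl)))
      (Ideal.mul_mem_left _ _ (Ideal.subset_span (Or.inr rfl)))⟩

/-- `ℚ[z^±]` is a finite module over the algebra: it is generated as an algebra
by the `z^{vᵢ}`, which are integral. -/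
theorem finite_symmAlgebra {v : Fin 3 → ℤ} (hsum : v 0 + v 1 + v 2 = 0)
    (hgcd : Finset.univ.gcd v = 1) : Module.Finite (symmAlgebra v) ℚ[T;T⁻¹] := by
  have hft : Algebra.FiniteType ℚ ℚ[T;T⁻¹] :=
    Algebra.FiniteType.of_surjective
      (MvPolynomial.aeval fun i => (T (v i) : ℚ[T;T⁻¹]) : MvPolynomial (Fin 3) ℚ →ₐ[ℚ] _)
      (substPowers_surjective hsum hgcd)
  have hft' : Algebra.FiniteType (symmAlgebra v) ℚ[T;T⁻¹] :=
    Algebra.FiniteType.of_restrictScalars_finiteType ℚ _ _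
  have hT : ∀ i, IsIntegral (symmAlgebra v) (T (v i) : ℚ[T;T⁻¹]) := by
    have hmonic : ∀ a b : symmAlgebra v, (Polynomial.X ^ 3 - Polynomial.C a * Polynomial.X ^ 2 +
        Polynomial.C b * Polynomial.X - 1).Monic := fun a b => by monicity!
    intro i
    refine ⟨Polynomial.X ^ 3 - Polynomial.C ⟨_, T_add_T_add_T_mem v⟩ * Polynomial.X ^ 2 +
      Polynomial.C ⟨_, esymm_two_mem v⟩ * Polynomial.X - 1, hmonic _ _, ?_⟩
    simp only [Polynomial.eval₂_add, Polynomial.eval₂_sub, Polynomial.eval₂_mul,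
      Polynomial.eval₂_pow, Polynomial.eval₂_X, Polynomial.eval₂_C,
      Polynomial.eval₂_one, Subalgebra.algebraMap_def, Algebra.algebraMap_self, RingHom.id_apply]
    linear_combination T_cubic_eq_zero hsum i
  have hint : Algebra.IsIntegral (symmAlgebra v) ℚ[T;T⁻¹] := ⟨fun F => by
    obtain ⟨p, rfl⟩ := substPowers_surjective hsum hgcd F
    induction p using MvPolynomial.induction_on with
    | C a =>
      have := isIntegral_algebraMap (R := symmAlgebra v) (A := ℚ[T;T⁻¹])
        (x := algebraMap ℚ (symmAlgebra v) a)
      simpa [substPowers] using this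
    | add p q hp hq => simpa [substPowers] using hp.add hq
    | mul_X p i hp =>
      rw [substPowers_mul]
      refine hp.mul ?_
      simpa [substPowers] using hT i⟩
  exact Algebra.IsIntegral.finite

/-- By Nakayama's lemma over the algebra, some element of the algebra is divisible by `Φ` and
congruent to `1` modulo `(z - 1)⁵`, whenever `Φ(1) ≠ 0`. -/
theorem exists_separating {v : Fin 3 → ℤ} (hsum : v 0 + v 1 + v 2 = 0)
    (hgcd : Finset.univ.gcd v = 1) {Φ : ℚ[T;T⁻¹]} (hΦ : evalOne Φ ≠ 0) :
    ∃ e ∈ symmAlgebra v, Φ ∣ e ∧ (T 1 - 1) ^ 5 ∣ e - 1 := by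
  have := finite_symmAlgebra hsum hgcd
  have mq : T (v 0) + T (v 1) + T (v 2) - 3 ∈ symmAlgebra v :=
    sub_mem (T_add_T_add_T_mem v) (ofNat_mem _ 3)
  have mr : T (v 0) * T (v 1) + T (v 0) * T (v 2) + T (v 1) * T (v 2) - 3 ∈ symmAlgebra v :=
    sub_mem (esymm_two_mem v) (ofNat_mem _ 3)
  set q := T (v 0) + T (v 1) + T (v 2) - (3 : ℚ[T;T⁻¹]) with hq
  set r := T (v 0) * T (v 1) + T (v 0) * T (v 2) + T (v 1) * T (v 2) - (3 : ℚ[T;T⁻¹]) with hr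
  let I : Ideal (symmAlgebra v) := Ideal.span {⟨q, mq⟩, ⟨r, mr⟩}
  let N : Submodule (symmAlgebra v) ℚ[T;T⁻¹] :=
    (Ideal.span {Φ} : Ideal ℚ[T;T⁻¹]).restrictScalars (symmAlgebra v)
  have htop : (⊤ : Submodule (symmAlgebra v) ℚ[T;T⁻¹]) ≤ N ⊔ I • ⊤ := by
    intro y _
    obtain ⟨n, hn⟩ := exists_T_sub_one_pow_mem hsum hgcd
    obtain ⟨a, b, hab⟩ := Ideal.mem_span_pair.1 hn
    obtain ⟨c, d, hcd⟩ := isCoprime_T_sub_one_pow hΦ n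
    have hy : y = y * d * Φ + (q * (y * c * a) + r * (y * c * b)) := by
      linear_combination (-y) * hcd - y * c * hab
    rw [hy]
    refine Submodule.add_mem_sup (Ideal.mem_span_singleton.2 (Dvd.intro_left _ rfl)) ?_
    have hsm : ∀ s ∈ I, ∀ w : ℚ[T;T⁻¹], (s : ℚ[T;T⁻¹]) * w ∈
        I • (⊤ : Submodule (symmAlgebra v) ℚ[T;T⁻¹]) :=
      fun s hs w => Submodule.smul_mem_smul hs (Submodule.mem_top (x := w))
    exact add_mem (hsm ⟨q, mq⟩ (Ideal.subset_span (by simp)) _)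
      (hsm ⟨r, mr⟩ (Ideal.subset_span (by simp)) _)
  obtain ⟨s, hs, hsN⟩ := Submodule.exists_sub_one_mem_and_smul_le_of_fg_of_le_sup
    Module.Finite.fg_top le_rfl htop
  have hΦs : Φ ∣ (s : ℚ[T;T⁻¹]) := by
    have : s • (1 : ℚ[T;T⁻¹]) ∈ N := hsN (Submodule.smul_mem_pointwise_smul _ _ _ trivial)
    rw [Algebra.smul_def, mul_one] at this
    exact Ideal.mem_span_singleton.1 this
  have hsq : ∀ F ∈ symmAlgebra v, evalOne F = 0 → (T 1 - 1) ^ 2 ∣ F := by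
    intro F hF h0
    obtain ⟨G, hG⟩ := exists_eq_C_add_sq (derivAtOne_eq_zero_of_mem hsum hF)
    rw [h0, map_zero, zero_add] at hG
    exact ⟨G, hG⟩
  have hI : I ≤ (Ideal.span {(T 1 - 1 : ℚ[T;T⁻¹]) ^ 2}).comap
      (algebraMap (symmAlgebra v) ℚ[T;T⁻¹]) := by
    refine Ideal.span_le.2 ?_
    rintro x (rfl | rfl)
    · refine Ideal.mem_span_singleton.2 (hsq q mq ?_)
      simp only [hq, map_sub, map_add, evalOne_T, map_ofNat]
      norm_num
    · refine Ideal.mem_span_singleton.2 (hsq r mr ?_)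
      simp only [hr, map_sub, map_add, map_mul, evalOne_T, map_ofNat]
      norm_num
  obtain ⟨G, hG⟩ : (T 1 - 1 : ℚ[T;T⁻¹]) ^ 2 ∣ (s : ℚ[T;T⁻¹]) - 1 :=
    Ideal.mem_span_singleton.1 (hI hs)
  -- cubing `1 - s` raises the order of contact with `1` from two to six
  refine ⟨1 - (1 - s) ^ 3, sub_mem (one_mem _) (pow_mem (sub_mem (one_mem _) s.2) 3), ?_, ?_⟩
  · have h : (1 - (1 - s) ^ 3 : ℚ[T;T⁻¹]) = s * (3 - 3 * s + s ^ 2) := by ring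
    rw [h]
    exact hΦs.mul_right _
  · refine ⟨(T 1 - 1) * G ^ 3, ?_⟩
    linear_combination (((s : ℚ[T;T⁻¹]) - 1) ^ 2 + (s - 1) * ((T 1 - 1) ^ 2 * G) +
      ((T 1 - 1) ^ 2 * G) ^ 2) * hG

/-- If `(z - 1)⁵ Φ` lies in the conductor and `Φ(1) ≠ 0`, then on multiples of `Φ` the only condition
for membership in the algebra is the vanishing of the derivative at `1`. -/
theorem mem_symmAlgebra_of_dvd {v : Fin 3 → ℤ} (hsum : v 0 + v 1 + v 2 = 0)
    (hprod : v 0 * v 1 * v 2 ≠ 0) (hgcd : Finset.univ.gcd v = 1) {Φ : ℚ[T;T⁻¹]}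
    (hΦ : evalOne Φ ≠ 0) (hcond : ∀ F : ℚ[T;T⁻¹], (T 1 - 1) ^ 5 * Φ * F ∈ symmAlgebra v)
    {F : ℚ[T;T⁻¹]} (hF : derivAtOne F = 0) (hdvd : Φ ∣ F) : F ∈ symmAlgebra v := by
  obtain ⟨e, he, hΦe, w, hw⟩ := exists_separating hsum hgcd hΦ
  obtain ⟨G, hG⟩ := exists_eq_C_add_sq hF
  obtain ⟨a, ha, H, hH⟩ := exists_mem_add_pow_five hsum hprod G
  -- `F` and `(F(1) + a) e` agree modulo `(z - 1)⁵` and are both divisible by `Φ`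
  have hm : (C (evalOne F) + a) * e ∈ symmAlgebra v :=
    mul_mem (add_mem ((symmAlgebra v).algebraMap_mem _) ha) he
  have hd : (T 1 - 1) ^ 5 * Φ ∣ F - (C (evalOne F) + a) * e := by
    refine (isCoprime_T_sub_one_pow hΦ 5).mul_dvd ⟨H - (C (evalOne F) + a) * w, ?_⟩
      (dvd_sub hdvd (hΦe.mul_left _))
    linear_combination hG + hH - (C (evalOne F) + a) * hw
  obtain ⟨R, hR⟩ := hd
  rw [← sub_add_cancel F ((C (evalOne F) + a) * e), hR]
  exact add_mem (hcond R) hm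

/-! ### Membership in the algebra is a condition modulo `Φ` -/

theorem mainTheorem1 (v : Fin 3 → ℤ) (hsum : v 0 + v 1 + v 2 = 0)
    (hprod : v 0 * v 1 * v 2 ≠ 0) (hgcd : Finset.univ.gcd v = 1) :
    ∃ Φ : Polynomial ℚ, IsProductOfCyclotomics Φ ∧ Φ.eval 1 ≠ 0 ∧
      ∃ C : Subalgebra ℚ (LaurentQuotient Φ),
        ∀ F : ℚ[T;T⁻¹],
          (∃ P : MvPolynomial (Fin 3) ℚ, P.IsSymmetric ∧ F = substPowers v P) ↔
            (laurentEvalOne (laurentDerivative F) = 0 ∧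
              Ideal.Quotient.mk (Ideal.span {Polynomial.toLaurent Φ}) F ∈ C) := by
  obtain ⟨Φ, hΦ, hΦ1, hcond⟩ := exists_conductor hsum hprod hgcd
  refine ⟨Φ, hΦ, hΦ1, (symmAlgebra v).map
    (Ideal.Quotient.mkₐ ℚ (Ideal.span {Polynomial.toLaurent Φ})), fun F => ?_⟩
  rw [← mem_symmAlgebra, laurentEvalOne_laurentDerivative]
  constructor
  · exact fun hF => ⟨derivAtOne_eq_zero_of_mem hsum hF, F, hF, rfl⟩
  · rintro ⟨hF, G, hG, hGF⟩
    have hdvd : Polynomial.toLaurent Φ ∣ F - G :=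
      Ideal.mem_span_singleton.1 (Ideal.Quotient.eq.1 hGF.symm)
    have hder : derivAtOne (F - G) = 0 := by
      rw [map_sub, hF, derivAtOne_eq_zero_of_mem hsum hG, sub_zero]
    rw [← sub_add_cancel F G]
    exact add_mem (mem_symmAlgebra_of_dvd hsum hprod hgcd
      (by rwa [evalOne_toLaurent]) hcond hder hdvd) hG
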